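/- Let $n,m\in\mathbb N$ and let $A,\bar A,C,\bar C,Q,\bar Q,G,\bar G\in\mathbb R^{n\times n}$, $B,\bar B,D,\bar D\in\mathbb R^{n\times m}$, $R,\bar R\in\mathbb R^{m\times m}$ be constant matrices. Write $\widehat\varphi=\varphi+\bar\varphi$ for $\varphi=A,B,C,D,Q,R,G$, and let $\|M\|=\sqrt{\rho(M^\top M)}$ be the spectral norm. Assume that $Q,\widehat Q,G,\widehat G$ are symmetric positive semi-definite and that $R,\widehat R$ are symmetric positive definite. Let $T>0$ and let $P,\Pi:[0,T]\to\mathbb R^{n\times n}$ be the (differentiable) solutions of the differential Riccati equations $$P'+PA+A^\top P+C^\top PC+Q-(B^\top P+D^\top PC)^\top\Sigma_0^{-1}(B^\top P+D^\top PC)=0\ \text{ in }[0,T],\qquad P(T)=G,$$ $$\Pi'+\Pi\widehat A+\widehat A^\top\Pi+\widehat C^\top P\widehat C+\widehat Q-(\widehat B^\top\Pi+\widehat D^\top P\widehat C)^\top\Sigma_1^{-1}(\widehat B^\top\Pi+\widehat D^\top P\widehat C)=0\ \text{ in }[0,T],\qquad \Pi(T)=\widehat G,$$ where $\Sigma_0=R+D^\top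 PD$ and $\Sigma_1=\widehat R+\widehat D^\top P\widehat D$. For an integer $N\ge1$ with $\tau=T/N\le1$ put $t_l=l\tau$, $l=0,\dots,N$. Let $P_0,\dots,P_N\in\mathbb R^{n\times n}$ solve the difference Riccati equation $$P_k=\tau Q+(I_n+\tau A)^\top P_{k+1}(I_n+\tau A)+\tau C^\top P_{k+1}C-\tau(H^1_k)^\top(W^1_k)^{-1}H^1_k\quad(0\le k\le N-1),\qquad P_N=G,$$ with $H^1_k=B^\top P_{k+1}(I_n+\tau A)+D^\top P_{k+1}C$ and $W^1_k=R+\tau B^\top P_{k+1}B+D^\top P_{k+1}D$. With $\widetilde R_k=\widehat R+\widehat D^\top P_k\widehat D$, $\widetilde A_k=\widehat A-\widehat B\widetilde R_k^{-1}\widehat D^\top P_k\widehat C$ and $\widetilde Q_k=\widehat Q+\widehat C^\top P_k\widehat C-\widehat C^\top P_k\widehat D\widetilde R_k^{-1}\widehat D^\top P_k\widehat C$, let $\Pi_0,\dots,\Pi_N\in\mathbb R^{n\times n}$ solve the difference Riccati equation $$\Pi_k=(I_n+\tau\widetilde A_k)^\top\Pi_{k+1}(I_n+\tau\widetilde A_k)+\tau\widetilde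 Q_k-\tau H_k^\top W_k^{-1}H_k\quad(0\le k\le N-1),\qquad \Pi_N=\widehat G,$$ with $H_k=\widehat B^\top\Pi_{k+1}(I_n+\tau\widetilde A_k)$ and $W_k=\widetilde R_k+\tau\widehat B^\top\Pi_{k+1}\widehat B$. Then there exists a constant $\mathcal C>0$, independent of $\tau$ (that is, of $N$), such that $$\max_{l=0,1,\dots,N}\|\Pi(t_l)-\Pi_l\|\le\mathcal C\,\tau .$$ -/

import Mathlib

open Set
open scoped Matrix Matrix.Norms.L2Operator

/-- The matrix norm `‖·‖` in force is the spectral norm `‖M‖ = √ρ(Mᵀ M)`. -/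
theorem spectralNorm_eq {n : ℕ} (M : Matrix (Fin n) (Fin n) ℝ) :
    ‖M‖ = √ (spectralRadius ℝ (Mᵀ * M)).toReal := by
  have h1 : spectralRadius ℝ (Mᵀ * M)
      = spectralRadius ℝ (Matrix.toEuclideanCLM (n := Fin n) (𝕜 := ℝ) (Mᵀ * M)) := by
    unfold spectralRadius
    rw [AlgEquiv.spectrum_eq]
  have hs : IsSelfAdjoint (Matrix.toEuclideanCLM (n := Fin n) (𝕜 := ℝ) (Mᵀ * M)) := by
    have : IsSelfAdjoint (Mᴴ * M) := IsSelfAdjoint.star_mul_self M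
    rw [Matrix.conjTranspose_eq_transpose_of_trivial] at this
    exact this.map _
  have h2 : spectralRadius ℝ (Matrix.toEuclideanCLM (n := Fin n) (𝕜 := ℝ) (Mᵀ * M))
      = ‖Matrix.toEuclideanCLM (n := Fin n) (𝕜 := ℝ) (Mᵀ * M)‖₊ :=
    ContinuousLinearMap.spectralRadius_eq_nnnorm _ hs
  rw [h1, h2, ENNReal.coe_toReal, coe_nnnorm,
    ← Matrix.cstar_norm_def, ← Matrix.conjTranspose_eq_transpose_of_trivial,
    Matrix.l2_opNorm_conjTranspose_mul_self, Real.sqrt_mul_self (norm_nonneg _)]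

/-- The coefficients of a mean-field linear quadratic control problem with state dimension `n` and
control dimension `m`; a trailing `b` stands for the bar (the mean-field coefficient). -/
structure MFLQ (n m : ℕ) where
  A : Matrix (Fin n) (Fin n) ℝ
  Ab : Matrix (Fin n) (Fin n) ℝ
  B : Matrix (Fin n) (Fin m) ℝ
  Bb : Matrix (Fin n) (Fin m) ℝ
  C : Matrix (Fin n) (Fin n) ℝ
  Cb : Matrix (Fin n) (Fin n) ℝ
  D : Matrix (Fin n) (Fin m) ℝ
  Db : Matrix (Fin n) (Fin m) ℝ
  Q : Matrix (Fin n) (Fin n) ℝ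
  Qb : Matrix (Fin n) (Fin n) ℝ
  R : Matrix (Fin m) (Fin m) ℝ
  Rb : Matrix (Fin m) (Fin m) ℝ
  G : Matrix (Fin n) (Fin n) ℝ
  Gb : Matrix (Fin n) (Fin n) ℝ

namespace MFLQ

variable {n m : ℕ} (d : MFLQ n m)

/-- The standing assumption (A). Positive (semi)definiteness includes symmetry. -/
structure AssumptionA : Prop where
  Q_nonneg : d.Q.PosSemidef
  QQb_nonneg : (d.Q + d.Qb).PosSemidef
  G_nonneg : d.G.PosSemidef
  GGb_nonneg : (d.G + d.Gb).PosSemidef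
  R_pos : d.R.PosDef
  RRb_pos : (d.R + d.Rb).PosDef

/-! The hatted coefficients, sums of a coefficient and its mean-field counterpart. -/

def Ah : Matrix (Fin n) (Fin n) ℝ := d.A + d.Ab
def Bh : Matrix (Fin n) (Fin m) ℝ := d.B + d.Bb
def Ch : Matrix (Fin n) (Fin n) ℝ := d.C + d.Cb
def Dh : Matrix (Fin n) (Fin m) ℝ := d.D + d.Db
def Qh : Matrix (Fin n) (Fin n) ℝ := d.Q + d.Qb
def Rh : Matrix (Fin m) (Fin m) ℝ := d.R + d.Rb
def Gh : Matrix (Fin n) (Fin n) ℝ := d.G + d.Gb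

/-- `Σ₀ = R + Dᵀ P D`. -/
def Sigma0 (P : Matrix (Fin n) (Fin n) ℝ) : Matrix (Fin m) (Fin m) ℝ :=
  d.R + d.Dᵀ * P * d.D

/-- `Σ₁ = R̂ + D̂ᵀ P D̂`. -/
def Sigma1 (P : Matrix (Fin n) (Fin n) ℝ) : Matrix (Fin m) (Fin m) ℝ :=
  d.Rh + d.Dhᵀ * P * d.Dh

/-- `P` solves the first differential Riccati equation
`P' + P A + Aᵀ P + Cᵀ P C + Q - (Bᵀ P + Dᵀ P C)ᵀ Σ₀⁻¹ (Bᵀ P + Dᵀ P C) = 0` on `[0, T]`, `P(T) = G`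
(with one-sided derivatives at the end points). -/
structure SolvesRiccati1 (T : ℝ) (P : ℝ → Matrix (Fin n) (Fin n) ℝ) : Prop where
  hasDeriv : ∀ t ∈ Icc (0 : ℝ) T,
    HasDerivWithinAt P
      (-(P t * d.A + d.Aᵀ * P t + d.Cᵀ * P t * d.C + d.Q
        - (d.Bᵀ * P t + d.Dᵀ * P t * d.C)ᵀ * (d.Sigma0 (P t))⁻¹
          * (d.Bᵀ * P t + d.Dᵀ * P t * d.C)))
      (Icc (0 : ℝ) T) t
  terminal : P T = d.G

/-- `Pi` solves the second differential Riccati equation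
`Π' + Π Â + Âᵀ Π + Ĉᵀ P Ĉ + Q̂ - (B̂ᵀ Π + D̂ᵀ P Ĉ)ᵀ Σ₁⁻¹ (B̂ᵀ Π + D̂ᵀ P Ĉ) = 0` on `[0, T]`,
`Π(T) = Ĝ`, in which `P` is the solution of the first one. -/
structure SolvesRiccati2 (T : ℝ) (P Pi : ℝ → Matrix (Fin n) (Fin n) ℝ) : Prop where
  hasDeriv : ∀ t ∈ Icc (0 : ℝ) T,
    HasDerivWithinAt Pi
      (-(Pi t * d.Ah + d.Ahᵀ * Pi t + d.Chᵀ * P t * d.Ch + d.Qh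
        - (d.Bhᵀ * Pi t + d.Dhᵀ * P t * d.Ch)ᵀ * (d.Sigma1 (P t))⁻¹
          * (d.Bhᵀ * Pi t + d.Dhᵀ * P t * d.Ch)))
      (Icc (0 : ℝ) T) t
  terminal : Pi T = d.Gh

/-- `H¹ₖ` as a function of `X = Pₖ₊₁`. -/
def H1 (τ : ℝ) (X : Matrix (Fin n) (Fin n) ℝ) : Matrix (Fin m) (Fin n) ℝ :=
  d.Bᵀ * X * (1 + τ • d.A) + d.Dᵀ * X * d.C

/-- `W¹ₖ` as a function of `X = Pₖ₊₁`. -/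
def W1 (τ : ℝ) (X : Matrix (Fin n) (Fin n) ℝ) : Matrix (Fin m) (Fin m) ℝ :=
  d.R + τ • (d.Bᵀ * X * d.B) + d.Dᵀ * X * d.D

/-- `P₀, …, P_N` solve the first difference Riccati equation with step size `τ`. -/
structure SolvesRiccatiD1 (τ : ℝ) (N : ℕ) (P : ℕ → Matrix (Fin n) (Fin n) ℝ) : Prop where
  step : ∀ k < N,
    P k = τ • d.Q + (1 + τ • d.A)ᵀ * P (k + 1) * (1 + τ • d.A) + τ • (d.Cᵀ * P (k + 1) * d.C)
      - τ • ((d.H1 τ (P (k + 1)))ᵀ * (d.W1 τ (P (k + 1)))⁻¹ * d.H1 τ (P (k + 1)))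
  terminal : P N = d.G

/-! The coefficients of the discrete auxiliary deterministic problem at time `k`, as functions of
`X = Pₖ`. -/

noncomputable def At (X : Matrix (Fin n) (Fin n) ℝ) : Matrix (Fin n) (Fin n) ℝ :=
  d.Ah - d.Bh * (d.Sigma1 X)⁻¹ * d.Dhᵀ * X * d.Ch

def Bt : Matrix (Fin n) (Fin m) ℝ := d.Bh

noncomputable def Qt (X : Matrix (Fin n) (Fin n) ℝ) : Matrix (Fin n) (Fin n) ℝ :=
  d.Qh + d.Chᵀ * X * d.Ch - d.Chᵀ * X * d.Dh * (d.Sigma1 X)⁻¹ * d.Dhᵀ * X * d.Ch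

noncomputable def Rt (X : Matrix (Fin n) (Fin n) ℝ) : Matrix (Fin m) (Fin m) ℝ := d.Sigma1 X

def Gt : Matrix (Fin n) (Fin n) ℝ := d.Gh

/-- `Hₖ = B̃ₖᵀ Πₖ₊₁ (Iₙ + τ Ãₖ)` as a function of `X = Pₖ` and `Y = Πₖ₊₁`. -/
noncomputable def H (τ : ℝ) (X Y : Matrix (Fin n) (Fin n) ℝ) : Matrix (Fin m) (Fin n) ℝ :=
  d.Btᵀ * Y * (1 + τ • d.At X)

/-- `Wₖ = R̃ₖ + τ B̃ₖᵀ Πₖ₊₁ B̃ₖ` as a function of `X = Pₖ` and `Y = Πₖ₊₁`. -/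
noncomputable def W (τ : ℝ) (X Y : Matrix (Fin n) (Fin n) ℝ) : Matrix (Fin m) (Fin m) ℝ :=
  d.Rt X + τ • (d.Btᵀ * Y * d.Bt)

/-- `Π₀, …, Π_N` solve the difference Riccati equation of the auxiliary discrete deterministic
problem with step size `τ`, in which `P₀, …, P_N` solve the first difference Riccati equation. -/
structure SolvesRiccatiD3 (τ : ℝ) (N : ℕ) (P Pi : ℕ → Matrix (Fin n) (Fin n) ℝ) : Prop where
  step : ∀ k < N,
    Pi k = (1 + τ • d.At (P k))ᵀ * Pi (k + 1) * (1 + τ • d.At (P k)) + τ • d.Qt (P k)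
      - τ • ((d.H τ (P k) (Pi (k + 1)))ᵀ * (d.W τ (P k) (Pi (k + 1)))⁻¹
          * d.H τ (P k) (Pi (k + 1)))
  terminal : Pi N = d.Gt

end MFLQ

/-! Run backwards from `T`, the two difference equations together form a one-step method `z ↦ z + τ
Φ(τ, z)` for the pair `z = (P, Π)`, and `Φ(0, ·)` is the right-hand side of the two reversed Riccati
equations along the exact solution. Such a consistent method converges to first order as soon as `Φ`
is C¹ near the curve `(0, (P, Π))` (`exists_oneStep_error_le`): for small steps the error bound
itself keeps the iterates in a tube where `Φ` is Lipschitz, so no a priori bound or positivity is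
needed for the discrete solutions.

Two facts about the exact solution remain. Smoothness of `Φ` requires `Σ₀` and `Σ₁` to be
invertible, which follows from `P(t) ≥ 0`; this is itself obtained from the scheme, whose steps
preserve positivity by completing the square and converge locally. Consistency requires `Π(t)` to be
symmetric, which follows from uniqueness for a linear ODE. The finitely many large steps are
absorbed into the constant. -/

/-! ### Convergence of one-step methods. -/

/-- Local Lipschitz continuity around a compact set gives a uniform Lipschitz estimate with one
point in the compact set. -/
theorem IsCompact.exists_uniform_lipschitz {α β : Type*} [PseudoMetricSpace α]
    [PseudoMetricSpace β] {s : Set α} (hs : IsCompact s) {g : α → β}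
    (hg : ∀ x ∈ s, ∃ C, ∃ U ∈ nhds x, LipschitzOnWith C g U) :
    ∃ L : ℝ, 0 ≤ L ∧ ∃ δ : ℝ, 0 < δ ∧
      ∀ x ∈ s, ∀ z, dist z x < δ → dist (g z) (g x) ≤ L * dist z x := by
  refine hs.induction_on ⟨0, le_rfl, 1, one_pos, by simp⟩ ?_ ?_ ?_
  · rintro s t hst ⟨L, hL, δ, hδ, h⟩
    exact ⟨L, hL, δ, hδ, fun x hx => h x (hst hx)⟩
  · rintro s t ⟨L, hL, δ, hδ, h⟩ ⟨L', hL', δ', hδ', h'⟩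
    refine ⟨max L L', hL.trans (le_max_left _ _), min δ δ', lt_min hδ hδ', ?_⟩
    rintro x (hx | hx) z hz
    · exact (h x hx z (hz.trans_le (min_le_left _ _))).trans
        (mul_le_mul_of_nonneg_right (le_max_left _ _) dist_nonneg)
    · exact (h' x hx z (hz.trans_le (min_le_right _ _))).trans
        (mul_le_mul_of_nonneg_right (le_max_right _ _) dist_nonneg)
  · intro x hx
    obtain ⟨C, U, hU, hC⟩ := hg x hx
    obtain ⟨ε, hε, hball⟩ := Metric.mem_nhds_iff.1 hU
    refine ⟨Metric.ball x (ε / 2), mem_nhdsWithin_of_mem_nhds (Metric.ball_mem_nhds _ (half_pos hε)),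
      C, C.2, ε / 2, half_pos hε, fun w hw z hz => hC.dist_le_mul z (hball ?_) w (hball ?_)⟩
    · rw [Metric.mem_ball] at hw ⊢
      linarith [dist_triangle z w x]
    · rw [Metric.mem_ball] at hw ⊢
      linarith

/-- A discrete Gronwall inequality with a linear growth factor. -/
theorem le_nat_mul_exp_of_step {e : ℕ → ℝ} {L h c : ℝ} (hLh : 0 ≤ L * h) (hc : 0 ≤ c)
    (h0 : e 0 ≤ 0) {N : ℕ}
    (hstep : ∀ l < N, e l ≤ l * c * Real.exp (l * (L * h)) → e (l + 1) ≤ (1 + L * h) * e l + c) :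
    ∀ l ≤ N, e l ≤ l * c * Real.exp (l * (L * h)) := by
  intro l
  induction l with
  | zero => simpa using h0
  | succ l ih =>
    intro hl
    have ih' := ih (by omega)
    have h1 : 1 + L * h ≤ Real.exp (L * h) := by linarith [Real.add_one_le_exp (L * h)]
    have h2 : (1 : ℝ) ≤ Real.exp ((l + 1 : ℕ) * (L * h)) := Real.one_le_exp (by positivity)
    calc e (l + 1) ≤ (1 + L * h) * e l + c := hstep l (by omega) ih'
      _ ≤ (1 + L * h) * (l * c * Real.exp (l * (L * h))) + c := by gcongr
      _ ≤ Real.exp (L * h) * (l * c * Real.exp (l * (L * h))) + c := by gcongr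
      _ = l * c * Real.exp ((l + 1 : ℕ) * (L * h)) + c * 1 := by
          have : ((l + 1 : ℕ) : ℝ) * (L * h) = l * (L * h) + L * h := by push_cast; ring
          rw [this, Real.exp_add]; ring
      _ ≤ l * c * Real.exp ((l + 1 : ℕ) * (L * h)) + c * Real.exp ((l + 1 : ℕ) * (L * h)) := by
          gcongr
      _ = _ := by push_cast; ring

/-- First-order convergence of a consistent one-step method, without global Lipschitz
assumptions: the increment function only has to be continuously differentiable near the
exact solution. -/
theorem exists_oneStep_error_le {E : Type*} [NormedAddCommGroup E] [NormedSpace ℝ E]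
    {Φ : ℝ × E → E} {y : ℝ → E} {a b : ℝ}
    (hΦ : ∀ t ∈ Icc a b, ContDiffAt ℝ 1 Φ (0, y t))
    (hy : ∀ t ∈ Icc a b, HasDerivWithinAt y (Φ (0, y t)) (Icc a b) t) :
    ∃ K : ℝ, 0 ≤ K ∧ ∃ h₀ : ℝ, 0 < h₀ ∧ ∀ h : ℝ, 0 < h → h < h₀ →
      ∀ (N : ℕ), a + N * h ≤ b → ∀ l ≤ N,
        ‖y (a + l * h) - (fun x => x + h • Φ (h, x))^[l] (y a)‖ ≤ K * h := by
  have hcy : ContinuousOn y (Icc a b) := fun t ht => (hy t ht).continuousWithinAt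
  have hcz : ContinuousOn (fun t => ((0 : ℝ), y t)) (Icc a b) := continuousOn_const.prodMk hcy
  obtain ⟨L, hL, δ, hδ, hLip⟩ := (isCompact_Icc.image_of_continuousOn hcz).exists_uniform_lipschitz
    (g := Φ) (by
      rintro _ ⟨t, ht, rfl⟩
      obtain ⟨C, U, hU, h⟩ := (hΦ t ht).exists_lipschitzOnWith
      exact ⟨C, U, hU, h⟩)
  have hcΦ : ContinuousOn (fun t => Φ (0, y t)) (Icc a b) := fun t ht =>
    ContinuousAt.comp_continuousWithinAt (g := Φ) (f := fun t => ((0 : ℝ), y t))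
      (hΦ t ht).continuousAt (hcz t ht)
  obtain ⟨M', hM'⟩ := isCompact_Icc.exists_bound_of_continuousOn hcΦ
  obtain ⟨M, hM0, hM⟩ : ∃ M : ℝ, 0 ≤ M ∧ ∀ t ∈ Icc a b, ‖Φ (0, y t)‖ ≤ M :=
    ⟨max M' 0, le_max_right _ _, fun t ht => (hM' t ht).trans (le_max_left _ _)⟩
  have hyLip : ∀ s ∈ Icc a b, ∀ t ∈ Icc a b, ‖y t - y s‖ ≤ M * ‖t - s‖ := fun s hs t ht =>
    (convex_Icc a b).norm_image_sub_le_of_norm_hasDerivWithin_le hy hM hs ht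
  have htrunc : ∀ h, 0 < h → M * h < δ → ∀ t ∈ Icc a b, t + h ∈ Icc a b →
      ‖y (t + h) - y t - h • Φ (0, y t)‖ ≤ L * (M * h) * h := by
    intro h hh hMh t ht hth
    have hsub : Icc t (t + h) ⊆ Icc a b := Icc_subset_Icc ht.1 hth.2
    -- Mean value inequality for `y` minus its tangent at `t`: the derivative `Φ(0, y s) - Φ(0, y
    -- t)` is at most `L M h`, so no second derivative of `y` is needed.
    have key := (convex_Icc t (t + h)).norm_image_sub_le_of_norm_hasDerivWithin_le
      (f := fun s => y s - (s - t) • Φ (0, y t)) (f' := fun s => Φ (0, y s) - Φ (0, y t))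
      (C := L * (M * h)) (x := t) (y := t + h) ?_ ?_ (left_mem_Icc.2 (by linarith))
      (right_mem_Icc.2 (by linarith))
    · have e : y (t + h) - (t + h - t) • Φ (0, y t) - (y t - (t - t) • Φ (0, y t))
          = y (t + h) - y t - h • Φ (0, y t) := by
        simp; abel
      rw [e] at key
      simpa [abs_of_pos hh] using key
    · intro s hs
      have h1 := (hy s (hsub hs)).mono hsub
      have h2 : HasDerivWithinAt (fun s => (s - t) • Φ (0, y t)) (Φ (0, y t)) (Icc t (t + h)) s := by
        simpa using (((hasDerivAt_id s).sub_const t).smul_const (Φ (0, y t))).hasDerivWithinAt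
      exact h1.sub h2
    · intro s hs
      have h1 : dist ((0 : ℝ), y s) ((0 : ℝ), y t) ≤ M * h := by
        rw [Prod.dist_eq, dist_self, max_eq_right dist_nonneg, dist_eq_norm]
        refine (hyLip t ht s (hsub hs)).trans (mul_le_mul_of_nonneg_left ?_ hM0)
        rw [Real.norm_eq_abs, abs_of_nonneg (by linarith [hs.1])]
        linarith [hs.2]
      have h2 := hLip _ ⟨t, ht, rfl⟩ _ (h1.trans_lt hMh)
      rw [dist_eq_norm] at h2
      exact h2.trans (mul_le_mul_of_nonneg_left h1 hL)
  -- The local error is `c h²`: `L M` comes from truncation, `L` from evaluating `Φ` at step `h`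
  -- instead of `0`.
  set c := L * (M + 1) with hc
  have hc0 : 0 ≤ c := by positivity
  set K := |b - a| * c * Real.exp (|b - a| * L) with hK
  have hK0 : 0 ≤ K := by positivity
  -- This threshold makes `M h`, `K h` and `h` all smaller than the tube radius `δ`.
  refine ⟨K, hK0, δ / (M + K + 1), by positivity, fun h hh hh0 N hN => ?_⟩
  have hsmall : (M + K + 1) * h < δ := by
    rwa [lt_div_iff₀ (by positivity), mul_comm] at hh0
  have hMh : M * h < δ := by nlinarith
  have hKh : K * h < δ := by nlinarith
  have hhδ : h < δ := by nlinarith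
  have hmem : ∀ l ≤ N, a + (l : ℝ) * h ∈ Icc a b := fun l hl => by
    have : (l : ℝ) * h ≤ N * h := by gcongr
    exact ⟨by linarith [show 0 ≤ (l : ℝ) * h by positivity], by linarith⟩
  have hfin : ∀ l ≤ N, l * (c * h ^ 2) * Real.exp (l * (L * h)) ≤ K * h := by
    intro l hl
    have h1 : (l : ℝ) * h ≤ |b - a| := by
      linarith [(hmem l hl).2, le_abs_self (b - a)]
    calc l * (c * h ^ 2) * Real.exp (l * (L * h))
        = (l * h) * c * Real.exp ((l * h) * L) * h := by ring_nf
      _ ≤ |b - a| * c * Real.exp (|b - a| * L) * h := by gcongr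
  intro l hl
  -- Bootstrap: the recursion for the error is needed only at indices where the claimed bound
  -- already holds, and there `K h < δ` puts the iterate inside the tube.
  refine (le_nat_mul_exp_of_step
    (e := fun l : ℕ => ‖y (a + l * h) - (fun x => x + h • Φ (h, x))^[l] (y a)‖)
    (L := L) (h := h) (c := c * h ^ 2) (by positivity) (by positivity) (by simp) (N := N) ?_
    l hl).trans (hfin l hl)
  intro l hl he
  have he' := he.trans (hfin l hl.le)
  simp only [Function.iterate_succ_apply'] at he' ⊢
  set u := (fun x => x + h • Φ (h, x))^[l] (y a)
  set t := a + (l : ℝ) * h with ht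
  have hth : a + ((l + 1 : ℕ) : ℝ) * h = t + h := by rw [ht]; push_cast; ring
  have htI := hmem l hl.le
  have hthI := hmem (l + 1) hl
  rw [hth] at hthI ⊢
  have h1 := htrunc h hh hMh t htI hthI
  have hd : dist (h, u) ((0 : ℝ), y t) ≤ h + ‖y t - u‖ := by
    rw [Prod.dist_eq]
    refine max_le ?_ ?_
    · simp [abs_of_pos hh]
    · simp only [dist_eq_norm]; rw [norm_sub_rev]; linarith
  have hd' : dist (h, u) ((0 : ℝ), y t) < δ := by
    rw [Prod.dist_eq]
    refine max_lt ?_ ?_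
    · simpa [abs_of_pos hh] using hhδ
    · simp only [dist_eq_norm]; rw [norm_sub_rev]; exact he'.trans_lt hKh
  have h2 := (hLip _ ⟨t, htI, rfl⟩ _ hd').trans (mul_le_mul_of_nonneg_left hd hL)
  rw [dist_eq_norm] at h2
  have e : y (t + h) - (u + h • Φ (h, u))
      = (y t - u) + (y (t + h) - y t - h • Φ (0, y t)) - h • (Φ (h, u) - Φ (0, y t)) := by
    rw [smul_sub]; abel
  rw [e]
  calc _ ≤ ‖y t - u‖ + ‖y (t + h) - y t - h • Φ (0, y t)‖ + ‖h • (Φ (h, u) - Φ (0, y t))‖ :=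
        (norm_sub_le _ _).trans (add_le_add_left (norm_add_le _ _) _)
    _ ≤ ‖y t - u‖ + L * (M * h) * h + h * (L * (h + ‖y t - u‖)) := by
        rw [norm_smul, Real.norm_eq_abs, abs_of_pos hh]; gcongr
    _ = _ := by rw [hc]; ring


/-! ### Smoothness and positivity of matrix expressions. -/

section MatrixCalculus

variable {E : Type*} [NormedAddCommGroup E] [NormedSpace ℝ E] {k l q : ℕ}

theorem Matrix.isBoundedBilinearMap_mul :
    IsBoundedBilinearMap ℝ
      (fun p : Matrix (Fin k) (Fin l) ℝ × Matrix (Fin l) (Fin q) ℝ => p.1 * p.2) where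
  add_left := Matrix.add_mul
  smul_left := fun c x y => Matrix.smul_mul c x y
  add_right := Matrix.mul_add
  smul_right := fun c x y => Matrix.mul_smul x c y
  bound := ⟨1, one_pos, fun x y => by simpa using Matrix.l2_opNorm_mul x y⟩

theorem ContDiffAt.matrix_mul {f : E → Matrix (Fin k) (Fin l) ℝ}
    {g : E → Matrix (Fin l) (Fin q) ℝ} {x : E} {r : WithTop ℕ∞} (hf : ContDiffAt ℝ r f x)
    (hg : ContDiffAt ℝ r g x) : ContDiffAt ℝ r (fun y => f y * g y) x :=
  ContDiffAt.comp (g := fun p : Matrix (Fin k) (Fin l) ℝ × Matrix (Fin l) (Fin q) ℝ => p.1 * p.2)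
    x Matrix.isBoundedBilinearMap_mul.contDiff.contDiffAt (hf.prodMk hg)

theorem Matrix.contDiff_transpose {r : WithTop ℕ∞} :
    ContDiff ℝ r (fun M : Matrix (Fin k) (Fin l) ℝ => Mᵀ) :=
  (LinearMap.toContinuousLinearMap
    (Matrix.transposeLinearEquiv (Fin k) (Fin l) ℝ ℝ).toLinearMap).contDiff

theorem ContDiffAt.matrix_transpose {f : E → Matrix (Fin k) (Fin l) ℝ} {x : E}
    {r : WithTop ℕ∞} (hf : ContDiffAt ℝ r f x) : ContDiffAt ℝ r (fun y => (f y)ᵀ) x :=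
  ContDiffAt.comp (g := fun M : Matrix (Fin k) (Fin l) ℝ => Mᵀ) x
    Matrix.contDiff_transpose.contDiffAt hf

theorem ContDiffAt.matrix_inv {f : E → Matrix (Fin k) (Fin k) ℝ} {x : E}
    {r : WithTop ℕ∞} (hf : ContDiffAt ℝ r f x) (hx : IsUnit (f x)) :
    ContDiffAt ℝ r (fun y => (f y)⁻¹) x := by
  obtain ⟨u, hu⟩ := hx
  simp only [Matrix.nonsing_inv_eq_ringInverse]
  have h := contDiffAt_ringInverse ℝ (n := r) u
  rw [hu] at h
  exact ContDiffAt.comp x h hf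

theorem HasDerivWithinAt.matrix_transpose {f : ℝ → Matrix (Fin k) (Fin l) ℝ}
    {f' : Matrix (Fin k) (Fin l) ℝ} {s : Set ℝ} {x : ℝ} (hf : HasDerivWithinAt f f' s x) :
    HasDerivWithinAt (fun y => (f y)ᵀ) f'ᵀ s x :=
  (LinearMap.toContinuousLinearMap
    (Matrix.transposeLinearEquiv (Fin k) (Fin l) ℝ ℝ).toLinearMap).hasFDerivAt.comp_hasDerivWithinAt
      x hf

theorem Matrix.isClosed_posSemidef : IsClosed {M : Matrix (Fin k) (Fin k) ℝ | M.PosSemidef} := by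
  simp only [Matrix.posSemidef_iff_dotProduct_mulVec, Matrix.IsHermitian, ofPred_and,
    ofPred_forall]
  refine IsClosed.inter (isClosed_eq ?_ continuous_id) (isClosed_iInter fun v => ?_)
  · exact (Matrix.contDiff_transpose (r := 0)).continuous
  · refine isClosed_le continuous_const ?_
    exact (LinearMap.continuous_of_finiteDimensional
      (((dotProductBilin ℝ ℝ (star v)).comp
        ((Matrix.mulVecBilin ℝ ℝ).flip v)) : Matrix (Fin k) (Fin k) ℝ →ₗ[ℝ] ℝ))

theorem Matrix.PosSemidef.transpose_mul_mul_same {X : Matrix (Fin k) (Fin k) ℝ}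
    (hX : X.PosSemidef) (M : Matrix (Fin k) (Fin l) ℝ) : (Mᵀ * X * M).PosSemidef := by
  simpa [Matrix.conjTranspose_eq_transpose_of_trivial] using hX.conjTranspose_mul_mul_same M

theorem Matrix.IsHermitian.transpose_eq {X : Matrix (Fin k) (Fin k) ℝ} (hX : X.IsHermitian) :
    Xᵀ = X := by
  rw [← Matrix.conjTranspose_eq_transpose_of_trivial]; exact hX

theorem HasDerivWithinAt.reverse_Icc {F : Type*} [NormedAddCommGroup F] [NormedSpace ℝ F]
    {f : ℝ → F} {f' : F} {T s : ℝ} (hf : HasDerivWithinAt f (-f') (Icc 0 T) (T - s)) :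
    HasDerivWithinAt (fun s => f (T - s)) f' (Icc 0 T) s := by
  have h : HasDerivWithinAt (fun s : ℝ => T - s) (-1) (Icc 0 T) s :=
    ((hasDerivAt_id s).const_sub T).hasDerivWithinAt
  simpa [Function.comp_def] using hf.scomp s h fun r hr => ⟨by linarith [hr.2], by linarith [hr.1]⟩

end MatrixCalculus

/-! ### The coupled Riccati scheme as a one-step method. -/

namespace MFLQ

variable {n m : ℕ} (d : MFLQ n m)

/-- The increment function of the first difference Riccati equation, `Pₖ = Pₖ₊₁ + τ Φ(τ, Pₖ₊₁)`. -/
noncomputable def incr1 (τ : ℝ) (X : Matrix (Fin n) (Fin n) ℝ) : Matrix (Fin n) (Fin n) ℝ :=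
  d.Q + X * d.A + d.Aᵀ * X + τ • (d.Aᵀ * X * d.A) + d.Cᵀ * X * d.C
    - (d.H1 τ X)ᵀ * (d.W1 τ X)⁻¹ * d.H1 τ X

/-- The increment function of the second difference Riccati equation, with `X = Pₖ` and
`Y = Πₖ₊₁`. -/
noncomputable def incr2 (τ : ℝ) (X Y : Matrix (Fin n) (Fin n) ℝ) : Matrix (Fin n) (Fin n) ℝ :=
  Y * d.At X + (d.At X)ᵀ * Y + τ • ((d.At X)ᵀ * Y * d.At X) + d.Qt X
    - (d.H τ X Y)ᵀ * (d.W τ X Y)⁻¹ * d.H τ X Y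

/-- The increment function of the coupled scheme `(Pₖ₊₁, Πₖ₊₁) ↦ (Pₖ, Πₖ)`. -/
noncomputable def incr (p : ℝ × (Matrix (Fin n) (Fin n) ℝ × Matrix (Fin n) (Fin n) ℝ)) :
    Matrix (Fin n) (Fin n) ℝ × Matrix (Fin n) (Fin n) ℝ :=
  (d.incr1 p.1 p.2.1, d.incr2 p.1 (p.2.1 + p.1 • d.incr1 p.1 p.2.1) p.2.2)

theorem one_add_smul_conj (τ : ℝ) (M X : Matrix (Fin n) (Fin n) ℝ) :
    (1 + τ • M)ᵀ * X * (1 + τ • M) = X + τ • (X * M + Mᵀ * X + τ • (Mᵀ * X * M)) := by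
  simp only [Matrix.transpose_add, Matrix.transpose_one, Matrix.transpose_smul, Matrix.add_mul,
    Matrix.mul_add, Matrix.one_mul, Matrix.mul_one, Matrix.smul_mul, Matrix.mul_smul, smul_add]
  abel

theorem SolvesRiccatiD1.step_eq {d : MFLQ n m} {τ : ℝ} {N : ℕ}
    {P : ℕ → Matrix (Fin n) (Fin n) ℝ} (h : d.SolvesRiccatiD1 τ N P) {k : ℕ} (hk : k < N) :
    P k = P (k + 1) + τ • d.incr1 τ (P (k + 1)) := by
  rw [h.step k hk, one_add_smul_conj, incr1]
  simp only [smul_add, smul_sub]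
  abel

theorem SolvesRiccatiD3.step_eq {d : MFLQ n m} {τ : ℝ} {N : ℕ}
    {P Pi : ℕ → Matrix (Fin n) (Fin n) ℝ} (h : d.SolvesRiccatiD3 τ N P Pi) {k : ℕ} (hk : k < N) :
    Pi k = Pi (k + 1) + τ • d.incr2 τ (P k) (Pi (k + 1)) := by
  rw [h.step k hk, one_add_smul_conj, incr2]
  simp only [smul_add, smul_sub]
  abel

/-- The equation for `Πₖ` uses `Pₖ`, not `Pₖ₊₁`; this is why `incr` feeds the already updated first
component into `incr2`. In particular the recursion determines the discrete solution completely. -/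
theorem eq_iterate_incr {τ : ℝ} {N : ℕ} {P Pi : ℕ → Matrix (Fin n) (Fin n) ℝ}
    (h : d.SolvesRiccatiD1 τ N P) (h' : d.SolvesRiccatiD3 τ N P Pi) :
    ∀ j ≤ N, (P (N - j), Pi (N - j)) = (fun z => z + τ • d.incr (τ, z))^[j] (d.G, d.Gh) := by
  intro j
  induction j with
  | zero => simp [h.terminal, h'.terminal, Gt]
  | succ j ih =>
    intro hj
    have hk : N - (j + 1) < N := by omega
    have e : N - (j + 1) + 1 = N - j := by omega
    have h1 := h.step_eq hk
    have h2 := h'.step_eq hk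
    rw [e] at h1 h2
    rw [Function.iterate_succ_apply', ← ih (by omega)]
    ext1
    · exact h1
    · simp only [incr, Prod.snd_add, Prod.smul_snd]
      rw [← h1, ← h2]

theorem Sigma0_posDef {d : MFLQ n m} (hA : d.AssumptionA) {X : Matrix (Fin n) (Fin n) ℝ}
    (hX : X.PosSemidef) : (d.Sigma0 X).PosDef :=
  hA.R_pos.add_posSemidef (hX.transpose_mul_mul_same _)

theorem Sigma1_posDef {d : MFLQ n m} (hA : d.AssumptionA) {X : Matrix (Fin n) (Fin n) ℝ}
    (hX : X.PosSemidef) : (d.Sigma1 X).PosDef :=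
  Matrix.PosDef.add_posSemidef (A := d.Rh) hA.RRb_pos (hX.transpose_mul_mul_same _)

theorem W1_posDef {d : MFLQ n m} (hA : d.AssumptionA) {τ : ℝ} (hτ : 0 ≤ τ)
    {X : Matrix (Fin n) (Fin n) ℝ} (hX : X.PosSemidef) : (d.W1 τ X).PosDef :=
  (hA.R_pos.add_posSemidef ((hX.transpose_mul_mul_same _).smul hτ)).add_posSemidef
    (hX.transpose_mul_mul_same _)

/-- One step of the first difference Riccati equation, after completing the square. -/
theorem add_smul_incr1_eq {τ : ℝ} {X : Matrix (Fin n) (Fin n) ℝ} (hX : Xᵀ = X)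
    {K : Matrix (Fin m) (Fin n) ℝ} (hWt : (d.W1 τ X)ᵀ = d.W1 τ X) (hW : IsUnit (d.W1 τ X))
    (hK : K = (d.W1 τ X)⁻¹ * d.H1 τ X) :
    X + τ • d.incr1 τ X = τ • d.Q + τ • (Kᵀ * d.R * K)
      + (1 + τ • d.A - τ • (d.B * K))ᵀ * X * (1 + τ • d.A - τ • (d.B * K))
      + τ • ((d.C - d.D * K)ᵀ * X * (d.C - d.D * K)) := by
  have hWK : d.W1 τ X * K = d.H1 τ X := by
    rw [hK, Matrix.mul_nonsing_inv_cancel_left _ _ ((Matrix.isUnit_iff_isUnit_det _).1 hW)]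
  have hKt : Kᵀ = (d.H1 τ X)ᵀ * (d.W1 τ X)⁻¹ := by
    rw [hK, Matrix.transpose_mul, Matrix.transpose_nonsing_inv, hWt]
  have e1 : (d.H1 τ X)ᵀ * (d.W1 τ X)⁻¹ * d.H1 τ X = Kᵀ * d.H1 τ X := by rw [hKt]
  have e2 : Kᵀ * d.H1 τ X = (d.H1 τ X)ᵀ * K := by rw [hKt, hK, Matrix.mul_assoc]
  have e3 : Kᵀ * (d.W1 τ X * K) = Kᵀ * d.H1 τ X := by rw [hWK]
  set M := 1 + τ • d.A with hM
  have e4 : X + τ • d.incr1 τ X = τ • d.Q + Mᵀ * X * M + τ • (d.Cᵀ * X * d.C)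
      - τ • (Kᵀ * d.H1 τ X) := by
    rw [hM, one_add_smul_conj, incr1, e1]
    simp only [smul_add, smul_sub]
    abel
  -- Since `Kᵀ H = Hᵀ K = Kᵀ W K`, the term `-Kᵀ H` may be written `-Kᵀ H - Hᵀ K + Kᵀ W K`, which
  -- supplies the cross and quadratic terms of the squares.
  have e5 : τ • (Kᵀ * d.H1 τ X) = τ • (Kᵀ * d.H1 τ X) + τ • ((d.H1 τ X)ᵀ * K)
      - τ • (Kᵀ * (d.W1 τ X * K)) := by rw [e3, ← e2]; abel
  rw [e4, e5, H1, W1]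
  simp only [← hM, Matrix.transpose_add, Matrix.transpose_sub, Matrix.transpose_smul,
    Matrix.transpose_mul, Matrix.transpose_transpose, hX, Matrix.add_mul, Matrix.mul_add,
    Matrix.sub_mul, Matrix.mul_sub, Matrix.smul_mul, Matrix.mul_smul, smul_add, smul_sub,
    Matrix.mul_assoc]
  abel

/-- After completing the square, every summand is a congruence of a positive semidefinite matrix, so
the minus sign has disappeared. -/
theorem posSemidef_add_smul_incr1 {d : MFLQ n m} (hA : d.AssumptionA) {τ : ℝ} (hτ : 0 ≤ τ)
    {X : Matrix (Fin n) (Fin n) ℝ} (hX : X.PosSemidef) :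
    (X + τ • d.incr1 τ X).PosSemidef := by
  have hW := W1_posDef hA hτ hX
  rw [d.add_smul_incr1_eq hX.isHermitian.transpose_eq hW.isHermitian.transpose_eq hW.isUnit rfl]
  exact (((hA.Q_nonneg.smul hτ).add ((hA.R_pos.posSemidef.transpose_mul_mul_same _).smul hτ)).add
    (hX.transpose_mul_mul_same _)).add ((hX.transpose_mul_mul_same _).smul hτ)

/-! ### Smoothness of the increment functions. -/

section Smooth

variable {E : Type*} [NormedAddCommGroup E] [NormedSpace ℝ E]
  {t : E → ℝ} {X Y : E → Matrix (Fin n) (Fin n) ℝ} {x : E}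

theorem contDiffAt_incr1 (ht : ContDiffAt ℝ 1 t x) (hX : ContDiffAt ℝ 1 X x)
    (hW : IsUnit (d.W1 (t x) (X x))) : ContDiffAt ℝ 1 (fun y => d.incr1 (t y) (X y)) x := by
  have hc : ∀ {k l : ℕ} (M : Matrix (Fin k) (Fin l) ℝ), ContDiffAt ℝ 1 (fun _ : E => M) x :=
    fun M => contDiffAt_const
  have h1 : ContDiffAt ℝ 1 (fun y => d.H1 (t y) (X y)) x :=
    (((hc _).matrix_mul hX).matrix_mul ((hc _).add (ht.smul (hc _)))).add
      (((hc _).matrix_mul hX).matrix_mul (hc _))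
  have h2 : ContDiffAt ℝ 1 (fun y => d.W1 (t y) (X y)) x :=
    ((hc _).add (ht.smul (((hc _).matrix_mul hX).matrix_mul (hc _)))).add
      (((hc _).matrix_mul hX).matrix_mul (hc _))
  exact (((((hc _).add (hX.matrix_mul (hc _))).add ((hc _).matrix_mul hX)).add
    (ht.smul (((hc _).matrix_mul hX).matrix_mul (hc _)))).add
      (((hc _).matrix_mul hX).matrix_mul (hc _))).sub
        ((h1.matrix_transpose.matrix_mul (h2.matrix_inv hW)).matrix_mul h1)

theorem contDiffAt_incr2 (ht : ContDiffAt ℝ 1 t x) (hX : ContDiffAt ℝ 1 X x)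
    (hY : ContDiffAt ℝ 1 Y x) (hS : IsUnit (d.Sigma1 (X x)))
    (hW : IsUnit (d.W (t x) (X x) (Y x))) :
    ContDiffAt ℝ 1 (fun y => d.incr2 (t y) (X y) (Y y)) x := by
  have hc : ∀ {k l : ℕ} (M : Matrix (Fin k) (Fin l) ℝ), ContDiffAt ℝ 1 (fun _ : E => M) x :=
    fun M => contDiffAt_const
  have h1 : ContDiffAt ℝ 1 (fun y => d.Sigma1 (X y)) x :=
    (hc _).add (((hc _).matrix_mul hX).matrix_mul (hc _))
  have h2 := h1.matrix_inv hS
  have h3 : ContDiffAt ℝ 1 (fun y => d.At (X y)) x :=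
    (hc _).sub (((((hc _).matrix_mul h2).matrix_mul (hc _)).matrix_mul hX).matrix_mul (hc _))
  have h4 : ContDiffAt ℝ 1 (fun y => d.Qt (X y)) x :=
    ((hc _).add (((hc _).matrix_mul hX).matrix_mul (hc _))).sub
      ((((((((hc _).matrix_mul hX).matrix_mul (hc _)).matrix_mul h2)).matrix_mul (hc _)).matrix_mul
        hX).matrix_mul (hc _))
  have h5 : ContDiffAt ℝ 1 (fun y => d.H (t y) (X y) (Y y)) x :=
    ((hc _).matrix_mul hY).matrix_mul ((hc _).add (ht.smul h3))
  have h6 : ContDiffAt ℝ 1 (fun y => d.W (t y) (X y) (Y y)) x :=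
    h1.add (ht.smul (((hc _).matrix_mul hY).matrix_mul (hc _)))
  exact ((((hY.matrix_mul h3).add (h3.matrix_transpose.matrix_mul hY)).add
    (ht.smul ((h3.matrix_transpose.matrix_mul hY).matrix_mul h3))).add h4).sub
      ((h5.matrix_transpose.matrix_mul (h6.matrix_inv hW)).matrix_mul h5)

end Smooth

/-! ### Consistency: increments at step size zero. -/

theorem H1_zero (X : Matrix (Fin n) (Fin n) ℝ) : d.H1 0 X = d.Bᵀ * X + d.Dᵀ * X * d.C := by
  simp [H1]

theorem W1_zero (X : Matrix (Fin n) (Fin n) ℝ) : d.W1 0 X = d.Sigma0 X := by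
  simp [W1, Sigma0]

theorem W_zero (X Y : Matrix (Fin n) (Fin n) ℝ) : d.W 0 X Y = d.Sigma1 X := by
  simp [W, Rt]

theorem incr1_zero (X : Matrix (Fin n) (Fin n) ℝ) :
    d.incr1 0 X = X * d.A + d.Aᵀ * X + d.Cᵀ * X * d.C + d.Q
      - (d.Bᵀ * X + d.Dᵀ * X * d.C)ᵀ * (d.Sigma0 X)⁻¹ * (d.Bᵀ * X + d.Dᵀ * X * d.C) := by
  rw [incr1, H1_zero, W1_zero, zero_smul]
  abel

/-- Expanding the square with `Σ₁⁻¹`, the cross terms are those hidden in `At` and the term free of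
`Y` is the one in `Qt`. The square produces `Yᵀ B̂` where `At` gives `Y B̂`, hence the symmetry of
`Y`. -/
theorem incr2_zero {X Y : Matrix (Fin n) (Fin n) ℝ} (hX : Xᵀ = X) (hY : Yᵀ = Y)
    (hS : (d.Sigma1 X)ᵀ = d.Sigma1 X) :
    d.incr2 0 X Y = Y * d.Ah + d.Ahᵀ * Y + d.Chᵀ * X * d.Ch + d.Qh
      - (d.Bhᵀ * Y + d.Dhᵀ * X * d.Ch)ᵀ * (d.Sigma1 X)⁻¹ * (d.Bhᵀ * Y + d.Dhᵀ * X * d.Ch) := by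
  rw [incr2, W_zero, H, At, Qt, Bt]
  simp only [zero_smul, add_zero, Matrix.transpose_add, Matrix.transpose_sub,
    Matrix.transpose_mul, Matrix.transpose_transpose, Matrix.transpose_nonsing_inv, hX, hY, hS,
    Matrix.add_mul, Matrix.mul_add, Matrix.sub_mul, Matrix.mul_sub, Matrix.mul_assoc,
    Matrix.mul_one]
  abel

/-! ### Positivity of `P` and symmetry of `Π`. -/

/-- Convergence of the scheme needs `Σ₀` invertible, which is to come from positivity of `P`.
Continuous induction breaks the circle: positivity at `s` makes `Σ₀` invertible on a short interval,
where `P` is a limit of positive semidefinite iterates. -/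
theorem SolvesRiccati1.posSemidef {d : MFLQ n m} (hA : d.AssumptionA) {T : ℝ}
    {P : ℝ → Matrix (Fin n) (Fin n) ℝ} (hP : d.SolvesRiccati1 T P) :
    ∀ t ∈ Icc (0 : ℝ) T, (P t).PosSemidef := by
  have hy : ∀ s ∈ Icc (0 : ℝ) T, HasDerivWithinAt (fun s => P (T - s)) (d.incr1 0 (P (T - s)))
      (Icc 0 T) s := fun s hs => by
    rw [incr1_zero]
    exact (hP.hasDeriv (T - s) ⟨by linarith [hs.2], by linarith [hs.1]⟩).reverse_Icc
  have hcy : ContinuousOn (fun s => P (T - s)) (Icc 0 T) := fun s hs =>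
    (hy s hs).continuousWithinAt
  suffices h : Icc 0 T ⊆ {s | (P (T - s)).PosSemidef} by
    intro t ht
    simpa using h (show T - t ∈ Icc 0 T from ⟨by linarith [ht.2], by linarith [ht.1]⟩)
  refine IsClosed.Icc_subset_of_forall_mem_nhdsWithin ?_ ?_ ?_
  · rw [inter_comm]
    exact hcy.preimage_isClosed_of_isClosed isClosed_Icc Matrix.isClosed_posSemidef
  · simpa [hP.terminal] using hA.G_nonneg
  rintro s ⟨hs, hsI⟩
  have hdet : ∀ᶠ r in nhdsWithin s (Icc 0 T), IsUnit (d.Sigma0 (P (T - r))) := by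
    have hc : Continuous (fun X : Matrix (Fin n) (Fin n) ℝ => d.Sigma0 X) := by
      unfold Sigma0; fun_prop
    exact (hc.continuousAt.comp_continuousWithinAt (hcy s ⟨hsI.1, hsI.2.le⟩)).eventually
      (Units.isOpen.mem_nhds (Sigma0_posDef hA hs).isUnit)
  obtain ⟨ε, hε, hball⟩ := Metric.mem_nhdsWithin_iff.1 hdet
  filter_upwards [Ioo_mem_nhdsGT (lt_min (lt_add_of_pos_right s hε) hsI.2)] with r hr
  have hrs : 0 < r - s := by linarith [hr.1]
  have hrε : r < s + ε := hr.2.trans_le (min_le_left _ _)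
  have hrT : r < T := hr.2.trans_le (min_le_right _ _)
  have hsub : Icc s r ⊆ Icc 0 T := Icc_subset_Icc hsI.1 hrT.le
  obtain ⟨K, hK, h₀, hh₀, hconv⟩ := exists_oneStep_error_le
    (Φ := fun p : ℝ × Matrix (Fin n) (Fin n) ℝ => d.incr1 p.1 p.2)
    (y := fun s => P (T - s)) (a := s) (b := r)
    (fun t ht => d.contDiffAt_incr1 contDiffAt_fst contDiffAt_snd (by
      rw [W1_zero]
      refine hball ⟨?_, hsub ht⟩
      rw [Metric.mem_ball, Real.dist_eq, abs_lt]
      exact ⟨by linarith [ht.1], by linarith [ht.2]⟩))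
    (fun t ht => (hy t (hsub ht)).mono hsub)
  have hpos : ∀ (h : ℝ), 0 ≤ h → ∀ l : ℕ,
      ((fun X => X + h • d.incr1 h X)^[l] (P (T - s))).PosSemidef := by
    intro h hh l
    induction l with
    | zero => exact hs
    | succ l ih =>
      rw [Function.iterate_succ_apply']
      exact posSemidef_add_smul_incr1 hA hh ih
  -- Exactly `N + 1` steps lead from `s` to `r`; the shift avoids division by zero.
  let h : ℕ → ℝ := fun N => (r - s) / (N + 1 : ℕ)
  have hlim : Filter.Tendsto h Filter.atTop (nhds 0) :=
    (tendsto_const_div_atTop_nhds_zero_nat (r - s)).comp (Filter.tendsto_add_atTop_nat 1)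
  have hhpos : ∀ N, 0 < h N := fun N => div_pos hrs (by positivity)
  have hmul : ∀ N, s + (N + 1 : ℕ) * h N = r := fun N => by
    have : ((N + 1 : ℕ) : ℝ) ≠ 0 := by positivity
    simp only [h]; rw [mul_div_cancel₀ _ this]; ring
  change P (T - r) ∈ {M : Matrix (Fin n) (Fin n) ℝ | M.PosSemidef}
  refine Matrix.isClosed_posSemidef.mem_of_tendsto (b := Filter.atTop)
    (f := fun N => (fun X => X + h N • d.incr1 (h N) X)^[N + 1] (P (T - s))) ?_
    (Filter.Eventually.of_forall fun N => hpos _ (hhpos N).le _)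
  rw [tendsto_iff_norm_sub_tendsto_zero]
  refine squeeze_zero' (Filter.Eventually.of_forall fun N => norm_nonneg _) ?_
    (by simpa using hlim.const_mul K)
  filter_upwards [hlim.eventually (gt_mem_nhds hh₀)] with N hN
  have := hconv (h N) (hhpos N) hN (N + 1) (hmul N).le (N + 1) le_rfl
  rw [hmul N] at this
  rw [norm_sub_rev]
  exact this

/-- The quadratic term is symmetric whether or not `Π` is, so it cancels in `Πᵀ - Π`, which
therefore solves a homogeneous linear ODE with zero data at `T`. -/
theorem SolvesRiccati2.transpose_eq {d : MFLQ n m} (hA : d.AssumptionA) {T : ℝ}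
    {P Pi : ℝ → Matrix (Fin n) (Fin n) ℝ} (hP : d.SolvesRiccati1 T P)
    (hPi : d.SolvesRiccati2 T P Pi) :
    ∀ t ∈ Icc (0 : ℝ) T, (Pi t)ᵀ = Pi t := by
  let f : Matrix (Fin n) (Fin n) ℝ →L[ℝ] Matrix (Fin n) (Fin n) ℝ := LinearMap.toContinuousLinearMap
    { toFun := fun E => E * d.Ah + d.Ahᵀ * E
      map_add' := fun E F => by rw [Matrix.add_mul, Matrix.mul_add]; abel
      map_smul' := fun c E => by simp }
  have hderiv : ∀ s ∈ Icc (0 : ℝ) T, HasDerivWithinAt (fun s => (Pi (T - s))ᵀ - Pi (T - s))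
      (f ((Pi (T - s))ᵀ - Pi (T - s))) (Icc 0 T) s := by
    intro s hs
    have hs' : T - s ∈ Icc (0 : ℝ) T := ⟨by linarith [hs.2], by linarith [hs.1]⟩
    have h := (hPi.hasDeriv (T - s) hs').reverse_Icc
    have hp := hP.posSemidef hA (T - s) hs'
    have hX := hp.isHermitian.transpose_eq
    have hS := (Sigma1_posDef hA hp).isHermitian.transpose_eq
    have hQ : d.Qhᵀ = d.Qh := hA.QQb_nonneg.isHermitian.transpose_eq
    refine (h.matrix_transpose.sub h).congr_deriv ?_
    change _ = _ * d.Ah + d.Ahᵀ * _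
    simp only [Matrix.transpose_add, Matrix.transpose_sub, Matrix.transpose_mul,
      Matrix.transpose_transpose, Matrix.transpose_nonsing_inv, hX, hS, hQ, Matrix.add_mul,
      Matrix.mul_add, Matrix.sub_mul, Matrix.mul_sub, Matrix.mul_assoc]
    abel
  have huniq := ODE_solution_unique_of_mem_Icc_right (v := fun _ => f) (s := fun _ => univ)
    (g := fun _ => 0) (fun _ _ => f.lipschitz.lipschitzOnWith)
    (fun s hs => (hderiv s hs).continuousWithinAt)
    (fun s hs => (hderiv s ⟨hs.1, hs.2.le⟩).mono_of_mem_nhdsWithin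
      (Icc_mem_nhdsGE_of_mem hs)) (fun _ _ => mem_univ _)
    continuousOn_const (fun s _ => by simpa using hasDerivWithinAt_const s (Ici s) _)
    (fun _ _ => mem_univ _)
    (by
      have hG : d.Ghᵀ = d.Gh := hA.GGb_nonneg.isHermitian.transpose_eq
      simp [hPi.terminal, hG])
  intro t ht
  have := huniq (show T - t ∈ Icc 0 T from ⟨by linarith [ht.2], by linarith [ht.1]⟩)
  simpa [sub_eq_zero] using this

/-- Convergence of the coupled scheme, with time running backwards from `T`. -/
theorem exists_incr_error_le {d : MFLQ n m} (hA : d.AssumptionA) {T : ℝ}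
    {P Pi : ℝ → Matrix (Fin n) (Fin n) ℝ}
    (hP : d.SolvesRiccati1 T P) (hPi : d.SolvesRiccati2 T P Pi) :
    ∃ K : ℝ, 0 ≤ K ∧ ∃ h₀ : ℝ, 0 < h₀ ∧ ∀ h : ℝ, 0 < h → h < h₀ →
      ∀ (N : ℕ), N * h ≤ T → ∀ l ≤ N,
        ‖(P (T - l * h), Pi (T - l * h)) - (fun z => z + h • d.incr (h, z))^[l] (d.G, d.Gh)‖
          ≤ K * h := by
  have hmem : ∀ s ∈ Icc (0 : ℝ) T, T - s ∈ Icc (0 : ℝ) T := fun s hs =>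
    ⟨by linarith [hs.2], by linarith [hs.1]⟩
  have key := exists_oneStep_error_le (Φ := d.incr) (y := fun s => (P (T - s), Pi (T - s)))
    (a := 0) (b := T) ?_ ?_
  · simpa [hP.terminal, hPi.terminal] using key
  · intro s hs
    have hp := hP.posSemidef hA _ (hmem s hs)
    have h1 : ContDiffAt ℝ 1
        (fun p : ℝ × (Matrix (Fin n) (Fin n) ℝ × Matrix (Fin n) (Fin n) ℝ) =>
          d.incr1 p.1 p.2.1) (0, (P (T - s), Pi (T - s))) := by
      refine d.contDiffAt_incr1 contDiffAt_fst (contDiffAt_fst.comp _ contDiffAt_snd) ?_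
      simpa only [W1_zero] using (Sigma0_posDef hA hp).isUnit
    have hS := (Sigma1_posDef hA hp).isUnit
    refine h1.prodMk (d.contDiffAt_incr2 contDiffAt_fst
      ((contDiffAt_fst.comp _ contDiffAt_snd).add (contDiffAt_fst.smul h1))
      (contDiffAt_snd.comp _ contDiffAt_snd) ?_ ?_)
    -- At step zero the updated first component is `P` itself.
    · simpa using hS
    · simpa [W_zero] using hS
  · intro s hs
    have hp := hP.posSemidef hA _ (hmem s hs)
    have h1 := (hP.hasDeriv _ (hmem s hs)).reverse_Icc
    have h2 := (hPi.hasDeriv _ (hmem s hs)).reverse_Icc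
    rw [← incr1_zero] at h1
    rw [← d.incr2_zero hp.isHermitian.transpose_eq (hPi.transpose_eq hA hP _ (hmem s hs))
      (Sigma1_posDef hA hp).isHermitian.transpose_eq] at h2
    simpa [incr] using h1.prodMk h2

end MFLQ

/-! ### The error estimate, uniform in the step size. -/

theorem mainTheorem2 {n m : ℕ} (d : MFLQ n m) (hA : d.AssumptionA) (T : ℝ) (hT : 0 < T)
    (P Pi : ℝ → Matrix (Fin n) (Fin n) ℝ)
    (hP : d.SolvesRiccati1 T P) (hPi : d.SolvesRiccati2 T P Pi) :
    ∃ K : ℝ, 0 < K ∧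
      ∀ (N : ℕ) (τ : ℝ), 0 < N → τ = T / N → τ ≤ 1 →
        ∀ Pd Pid : ℕ → Matrix (Fin n) (Fin n) ℝ,
          d.SolvesRiccatiD1 τ N Pd → d.SolvesRiccatiD3 τ N Pd Pid →
            ∀ l ≤ N, ‖Pi (l * τ) - Pid l‖ ≤ K * τ := by
  obtain ⟨K, hK, h₀, hh₀, hconv⟩ := MFLQ.exists_incr_error_le hA hP hPi
  let err : ℕ → ℕ → ℝ := fun N j => ‖(P (T - j * (T / N)), Pi (T - j * (T / N)))
    - (fun z => z + (T / N) • d.incr (T / N, z))^[j] (d.G, d.Gh)‖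
  have herr : ∀ N j, 0 ≤ err N j := fun N j => norm_nonneg _
  obtain ⟨N₀, hN₀⟩ := exists_nat_gt (T / h₀)
  -- Steps `T / N ≥ h₀` occur only for `N < N₀`. As `err` depends on `N` and `j` alone, this finite
  -- sum bounds all the remaining ratios of error to step.
  let K' : ℝ := ∑ N ∈ Finset.range N₀, ∑ j ∈ Finset.range (N + 1), err N j / (T / N)
  have hK' : 0 ≤ K' := Finset.sum_nonneg fun N _ => Finset.sum_nonneg fun j _ =>
    div_nonneg (herr N j) (by positivity)
  refine ⟨K + K' + 1, by positivity, ?_⟩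
  rintro N τ hN rfl - Pd Pid hPd hPid l hl
  have hN' : (0 : ℝ) < N := Nat.cast_pos.2 hN
  have hτ : 0 < T / N := div_pos hT hN'
  -- Index `l` is reached after `N - l` backward steps, and the error of the second component is at
  -- most that of the pair.
  have hle : ‖Pi (l * (T / N)) - Pid l‖ ≤ err N (N - l) := by
    have ht : T - ((N - l : ℕ) : ℝ) * (T / N) = l * (T / N) := by
      rw [Nat.cast_sub hl]; field_simp; ring
    have hit := d.eq_iterate_incr hPd hPid (N - l) (Nat.sub_le _ _)
    rw [Nat.sub_sub_self hl] at hit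
    simp only [err]
    rw [ht, ← hit]
    exact norm_snd_le (_, _)
  refine hle.trans ?_
  by_cases hsmall : T / N < h₀
  · have := hconv (T / N) hτ hsmall N (by rw [mul_div_cancel₀ _ hN'.ne']) (N - l) (Nat.sub_le _ _)
    refine this.trans ?_
    gcongr
    linarith
  · have hNN : N < N₀ := by
      have h1 : (N : ℝ) ≤ T / h₀ := by
        rw [not_lt, le_div_iff₀ hN'] at hsmall
        rw [le_div_iff₀ hh₀]
        linarith
      exact_mod_cast h1.trans_lt hN₀
    have h1 : err N (N - l) / (T / N) ≤ K' :=
      (Finset.single_le_sum (f := fun j => err N j / (T / N))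
        (fun j _ => div_nonneg (herr N j) hτ.le)
        (Finset.mem_range.2 (by omega : N - l < N + 1))).trans
      (Finset.single_le_sum (f := fun N : ℕ => ∑ j ∈ Finset.range (N + 1), err N j / (T / N))
        (fun N _ => Finset.sum_nonneg fun j _ => div_nonneg (herr N j) (by positivity))
        (Finset.mem_range.2 hNN))
    rw [div_le_iff₀ hτ] at h1
    refine h1.trans ?_
    gcongr
    linarith
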